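/- **Definitions.** A *network* $\mathcal N$ consists of $n$ horizontal lines (*levels*, labeled from bottom to top) and $m$ vertical segments (*commutators*, labeled from left to right), each joining two consecutive levels, no two having a common endpoint. Its *bricks* are its bounded cells: each brick lies between two consecutive levels, and between two commutators joining these levels with no other commutator joining them in between. A *pseudoline* is an abscissa-monotone path on $\mathcal N$ from its left end to its right end. A *crossing* of two pseudolines is a commutator traversed by both; a *contact* of two pseudolines is a commutator traversed by neither, whose endpoints are contained one in each. A *pseudoline arrangement* supported by $\mathcal N$ is a set of $n$ pseudolines on $\mathcal N$ such that any two have precisely one crossing, possibly some contacts, and no other intersection; its $i$-th pseudoline is the one starting at level $i$. Let $\mathrm{Arr}(\mathcal N)$ be the set of these arrangements; $\mathcal N$ is *sorting* if $\mathrm{Arr}(\mathcal N)\neq\emptyset$. For $\Lambda\in\mathrm{Arr}(\mathcal N)$, the *brick vector* $\omega(\Lambda)\in\mathbb R^n$ has as $i$-th coordinate the number of bricks of $\mathcal N$ located below the $i$-th pseudoline of $\Lambda$. The *brick polytope* is $\Omega(\mathcal N)=\operatorname{conv}\{\omega(\Lambda)\mid\Lambda\in\mathrm{Arr}(\mathcal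 N)\}$. The *contact graph* $\Lambda^\#$ is the directed multigraph on $\{1,\dots,n\}$ with one arc $(i,j)$ for each contact of $\Lambda$ at which the $i$-th pseudoline passes above and the $j$-th pseudoline passes below. A sorting network is *irreducible* if the contact graphs of the pseudoline arrangements it supports are connected (as undirected graphs). For $X\subseteq\mathbb R^n$, $\operatorname{cone}X$ is the set of finite linear combinations of elements of $X$ with nonnegative coefficients (so $\operatorname{cone}\emptyset=\{0\}$). The *cone of $\Omega(\mathcal N)$ at $\omega(\Lambda)$* is $\operatorname{cone}\{x-\omega(\Lambda)\mid x\in\Omega(\mathcal N)\}$, and the *incidence cone* of $\Lambda^\#$ is $C(\Lambda^\#)=\operatorname{cone}\{e_j-e_i\mid (i,j)\in\Lambda^\#\}$, where $(e_1,\dots,e_n)$ is the canonical basis of $\mathbb R^n$. **Theorem.** Let $\mathcal N$ be an irreducible sorting network and $\Lambda$ a pseudoline arrangement supported by $\mathcal N$. Then the cone of the brick polytope $\Omega(\mathcal N)$ at the brick vector $\omega(\Lambda)$ is precisely the incidence cone $C(\Lambda^\#)$ of the contact graph of $\Lambda$, and $$\operatorname{cone}\{\omega(\Lambda')-\omega(\Lambda)\mid\Lambda'\in\mathrm{Arr}(\mathcal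 N)\}=\operatorname{cone}\{e_j-e_i\mid(i,j)\in\Lambda^\#\}.$$ -/

import Mathlib

namespace BrickPolytope

/-- A network with `n` horizontal levels (numbered `0, …, n - 1` from bottom to top) and `m`
commutators (numbered `0, …, m - 1` from left to right). The commutator `k` is a vertical segment
joining the level `bot k` to the next level `top k`. -/
structure Network (n m : ℕ) where
  bot : Fin m → Fin n
  top : Fin m → Fin n
  top_eq : ∀ k, (top k : ℕ) = (bot k : ℕ) + 1

variable {n m : ℕ}

/-- An abscissa-monotone path on a network, from its left end to its right end. The `m` commutators
cut the abscissa axis into `m + 1` intervals, the interval `t` lying between the commutators `t - 1`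
and `t`; `level t` is the level on which the path runs over the interval `t`. At a commutator, the
path stays on its level, or traverses the commutator upwards or downwards. -/
structure Pseudoline (N : Network n m) where
  level : Fin (m + 1) → Fin n
  step : ∀ k : Fin m,
    level k.succ = level k.castSucc ∨
    (level k.castSucc = N.bot k ∧ level k.succ = N.top k) ∨
    (level k.castSucc = N.top k ∧ level k.succ = N.bot k)

namespace Pseudoline

variable {N : Network n m}

/-- The pseudoline `p` traverses the commutator `k`. -/
def Traverses (p : Pseudoline N) (k : Fin m) : Prop :=
  level p k.castSucc ≠ level p k.succ

/-- The commutator `k` is a crossing between `p` and `q`: both traverse it. -/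
def IsCrossing (p q : Pseudoline N) (k : Fin m) : Prop :=
  p.Traverses k ∧ q.Traverses k

/-- The commutator `k` is a contact between `p`, passing above it through its top endpoint, and `q`,
passing below it through its bottom endpoint; neither traverses it. -/
def IsContact (p q : Pseudoline N) (k : Fin m) : Prop :=
  (¬ p.Traverses k ∧ p.level k.castSucc = N.top k) ∧
  (¬ q.Traverses k ∧ q.level k.castSucc = N.bot k)

end Pseudoline

/-- A pseudoline arrangement (with contacts) supported by `N`: `n` pseudolines, any two of which have
precisely one crossing, possibly some contacts, and no other intersection. The pseudolines of an
arrangement start on distinct levels, and are labeled by the level on which they start. -/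
structure Arrangement (N : Network n m) where
  line : Fin n → Pseudoline N
  start : ∀ i, (line i).level 0 = i
  crossing : ∀ i j, i ≠ j → ∃! k, (line i).IsCrossing (line j) k
  disjoint : ∀ i j, i ≠ j → ∀ t, (line i).level t ≠ (line j).level t

/-- A directed multigraph with node set `V`. -/
structure DirectedMultigraph (V : Type) where
  Arc : Type
  source : Arc → V
  target : Arc → V

namespace DirectedMultigraph

/-- The underlying undirected graph is connected. -/
def IsConnected {V : Type} (G : DirectedMultigraph V) : Prop :=
  (SimpleGraph.fromRel fun u v => ∃ a, G.source a = u ∧ G.target a = v).Connected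

/-- The incidence configuration: the vectors `e_j - e_i`, for the arcs `(i, j)`. -/
def incidenceConfiguration (G : DirectedMultigraph (Fin n)) : Set (Fin n → ℝ) :=
  {v | ∃ a : G.Arc, v = Pi.single (G.target a) 1 - Pi.single (G.source a) 1}

/-- The incidence cone: the cone generated by the incidence configuration. -/
def incidenceCone (G : DirectedMultigraph (Fin n)) : PointedCone ℝ (Fin n → ℝ) :=
  PointedCone.hull ℝ G.incidenceConfiguration

end DirectedMultigraph

/-- The contact graph: one node for each pseudoline, and one arc for each contact, from the
pseudoline passing above the contact to the pseudoline passing below it. An arc is a triple made of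
a contact `k` and the labels of these two pseudolines (which are determined by `k`). -/
def Arrangement.contactGraph {N : Network n m} (L : Arrangement N) :
    DirectedMultigraph (Fin n) where
  Arc := {a : Fin m × Fin n × Fin n // (L.line a.2.1).IsContact (L.line a.2.2) a.1}
  source a := a.1.2.1
  target a := a.1.2.2

namespace Network

/-- A brick is a bounded cell: it lies between two consecutive levels, and between two commutators
`b.1 < b.2` joining these levels that are consecutive among all the commutators joining them. -/
def bricks (N : Network n m) : Set (Fin m × Fin m) :=
  {b | b.1 < b.2 ∧ N.bot b.1 = N.bot b.2 ∧ ∀ k, b.1 < k → k < b.2 → N.bot k ≠ N.bot b.1}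

/-- The network supports at least one pseudoline arrangement. -/
def IsSorting (N : Network n m) : Prop := Nonempty (Arrangement N)

/-- A sorting network is irreducible when the contact graphs of the pseudoline arrangements that it
supports are connected. -/
def IsIrreducible (N : Network n m) : Prop :=
  N.IsSorting ∧ ∀ L : Arrangement N, L.contactGraph.IsConnected

end Network

/-- The brick `b` lies below the pseudoline `p`: over every interval of abscissae covered by `b`, the
pseudoline runs on or above the level bounding `b` from above. -/
def Pseudoline.IsAboveBrick {N : Network n m} (p : Pseudoline N) (b : Fin m × Fin m) : Prop :=
  ∀ t : Fin (m + 1), b.1.castSucc < t → t ≤ b.2.castSucc → N.top b.1 ≤ p.level t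

/-- The brick vector: its `i`-th coordinate is the number of bricks below the `i`-th pseudoline. -/
noncomputable def Arrangement.brickVector {N : Network n m} (L : Arrangement N) : Fin n → ℝ :=
  fun i => ({b ∈ N.bricks | (L.line i).IsAboveBrick b}.ncard : ℝ)

/-- The brick polytope: the convex hull of the brick vectors. -/
def Network.brickPolytope (N : Network n m) : Set (Fin n → ℝ) :=
  convexHull ℝ (Set.range fun L : Arrangement N => L.brickVector)

/-- The cone of the set `P` at the point `x`: the cone generated by the vectors `y - x`, `y ∈ P`. -/
def coneAt (P : Set (Fin n → ℝ)) (x : Fin n → ℝ) : PointedCone ℝ (Fin n → ℝ) :=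
  PointedCone.hull ℝ {v | ∃ y ∈ P, v = y - x}

end BrickPolytope

/-!
Flipping a contact between two pseudolines `i` (above) and `j` (below) of an arrangement, that is,
exchanging `i` and `j` between this contact and their crossing, yields another arrangement, whose
brick vector differs by a positive multiple of `e_j - e_i` (`Arrangement.exists_flip`). Hence the
incidence cone is contained in the cone generated by the differences of brick vectors.

Conversely, by Farkas' lemma (`mem_hull_image_of_forall_nonneg`), it suffices to show that a linear
functional `f` which does not decrease along the arcs of the contact graph of `L`, that is, which no
flip of `L` decreases, is minimized by `L` among all arrangements (`IsCompatible.dotProduct_le`).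
Color the pseudolines by the values of `f`. The value of `f` at the brick vector, and the
compatibility with `f`, only depend on the colors seen on each level over each interval. Flips between
pseudolines of the same color preserve these, so ties of `f` can be broken by a linear order of the
pseudolines (`exists_sameColoring_isCompatible`). Everything then follows from the fact that a linear
order is compatible with at most one arrangement (`eq_of_isCompatible_permFunctional`). For the order
of the labels, this is the greedy arrangement, in which pseudolines cross when they first meet. Two
orders differing by an exchange of consecutive elements `a` and `b` degenerate to a common functional
with `f a = f b`, and so their compatible arrangements have the same coloring; uniqueness for one
order then gives uniqueness for the other (`eq_of_sameColoring`).

The cone of the convex hull is the cone generated by the differences of brick vectors, because cones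
are convex.
-/

namespace BrickPolytope

variable {n m : ℕ} {N : Network n m}

/-! ### Order of the pseudolines along a network -/

/-- Propagation along the abscissa axis of a property that no commutator in between changes. -/
lemma iff_of_forall_step {P : Fin (m + 1) → Prop} {s t : Fin (m + 1)} (hst : s ≤ t)
    (h : ∀ k : Fin m, s ≤ k.castSucc → k.succ ≤ t → (P k.castSucc ↔ P k.succ)) : P s ↔ P t := by
  induction t using Fin.induction with
  | zero => rw [Fin.le_zero_iff.1 hst]
  | succ k ih =>
    rcases hst.eq_or_lt with rfl | hlt
    · rfl
    · have hk : s ≤ k.castSucc := Fin.le_castSucc_iff.2 hlt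
      rw [ih hk fun l h₁ h₂ => h l h₁ (h₂.trans (Fin.castSucc_lt_succ).le)]
      exact h k hk le_rfl

namespace Pseudoline

variable (p q : Pseudoline N) (k : Fin m)

lemma step_nat :
    (p.level k.succ : ℕ) = p.level k.castSucc ∨
    ((p.level k.castSucc : ℕ) = N.bot k ∧ (p.level k.succ : ℕ) = N.bot k + 1) ∨
    ((p.level k.castSucc : ℕ) = N.bot k + 1 ∧ (p.level k.succ : ℕ) = N.bot k) := by
  have ht := N.top_eq k
  rcases p.step k with h | ⟨h₁, h₂⟩ | ⟨h₁, h₂⟩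
  · exact Or.inl (by rw [h])
  · exact Or.inr (Or.inl ⟨by rw [h₁], by rw [h₂, ht]⟩)
  · exact Or.inr (Or.inr ⟨by rw [h₁, ht], by rw [h₂]⟩)

lemma traverses_iff_nat : p.Traverses k ↔ (p.level k.castSucc : ℕ) ≠ p.level k.succ := by
  rw [Traverses, ne_eq, Fin.ext_iff]

lemma isCrossing_iff_nat : p.IsCrossing q k ↔
    (p.level k.castSucc : ℕ) ≠ p.level k.succ ∧ (q.level k.castSucc : ℕ) ≠ q.level k.succ := by
  rw [IsCrossing, traverses_iff_nat, traverses_iff_nat]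

lemma isContact_iff_nat : p.IsContact q k ↔
    (p.level k.castSucc : ℕ) = N.bot k + 1 ∧ (p.level k.succ : ℕ) = N.bot k + 1 ∧
    (q.level k.castSucc : ℕ) = N.bot k ∧ (q.level k.succ : ℕ) = N.bot k := by
  rw [IsContact, traverses_iff_nat, traverses_iff_nat, Fin.ext_iff, Fin.ext_iff, N.top_eq]
  omega

variable {p q k}

lemma lt_iff_lt_succ_of_not_isCrossing (h₁ : p.level k.castSucc ≠ q.level k.castSucc)
    (h₂ : p.level k.succ ≠ q.level k.succ) (hc : ¬ p.IsCrossing q k) :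
    p.level k.castSucc < q.level k.castSucc ↔ p.level k.succ < q.level k.succ := by
  have hp := p.step_nat k
  have hq := q.step_nat k
  rw [isCrossing_iff_nat] at hc
  rw [ne_eq, Fin.ext_iff] at h₁ h₂
  rw [Fin.lt_def, Fin.lt_def]
  omega

lemma lt_iff_succ_lt_of_isCrossing (hc : p.IsCrossing q k) :
    p.level k.castSucc < q.level k.castSucc ↔ q.level k.succ < p.level k.succ := by
  have hp := p.step_nat k
  have hq := q.step_nat k
  rw [isCrossing_iff_nat] at hc
  rw [Fin.lt_def, Fin.lt_def]
  omega

end Pseudoline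

namespace Arrangement

variable (L L' : Arrangement N)

/-- The level of the pseudoline `i` of `L` over the interval `t`, as a natural number. -/
def height (i : Fin n) (t : Fin (m + 1)) : ℕ := ((L.line i).level t : ℕ)

lemma height_ne {i j : Fin n} (h : i ≠ j) (t : Fin (m + 1)) : L.height i t ≠ L.height j t :=
  fun e => L.disjoint i j h t (Fin.ext e)

lemma eq_of_height_eq {i j : Fin n} {t : Fin (m + 1)} (h : L.height i t = L.height j t) : i = j := by
  by_contra hij
  exact L.height_ne hij t h

lemma height_zero (i : Fin n) : L.height i 0 = i := by rw [height, L.start]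

lemma height_step (i : Fin n) (k : Fin m) :
    L.height i k.succ = L.height i k.castSucc ∨
    (L.height i k.castSucc = N.bot k ∧ L.height i k.succ = N.bot k + 1) ∨
    (L.height i k.castSucc = N.bot k + 1 ∧ L.height i k.succ = N.bot k) :=
  (L.line i).step_nat k

variable {L L'}

lemma ext_height (h : ∀ i t, L.height i t = L'.height i t) : L = L' := by
  obtain ⟨l, _, _, _⟩ := L
  obtain ⟨l', _, _, _⟩ := L'
  have : l = l' := by
    funext i
    have hi : ∀ t, (l i).level t = (l' i).level t := fun t => Fin.ext (h i t)
    revert hi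
    rcases l i with ⟨u, _⟩
    rcases l' i with ⟨v, _⟩
    intro hi
    obtain rfl : u = v := funext hi
    rfl
  subst this
  rfl

instance : Finite (Arrangement N) :=
  Finite.of_injective (fun (L : Arrangement N) i t => (L.line i).level t) fun L L' h =>
    ext_height fun i t => by simp only [height, congrFun (congrFun h i) t]

/-- Over each interval, the levels of the pseudolines form a permutation. -/
noncomputable def levelEquiv (L : Arrangement N) (t : Fin (m + 1)) : Fin n ≃ Fin n :=
  Equiv.ofBijective (fun i => (L.line i).level t)
    (Finite.injective_iff_bijective.1 fun _ _ h => L.eq_of_height_eq (congrArg Fin.val h))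

lemma exists_height_eq (L : Arrangement N) (t : Fin (m + 1)) (l : Fin n) :
    ∃ i, L.height i t = l := by
  obtain ⟨i, hi⟩ := (L.levelEquiv t).surjective l
  exact ⟨i, congrArg Fin.val hi⟩

lemma isCrossing_iff {i j : Fin n} {k : Fin m} : (L.line i).IsCrossing (L.line j) k ↔
    L.height i k.castSucc ≠ L.height i k.succ ∧ L.height j k.castSucc ≠ L.height j k.succ :=
  Pseudoline.isCrossing_iff_nat _ _ _

lemma isContact_iff {i j : Fin n} {k : Fin m} : (L.line i).IsContact (L.line j) k ↔
    L.height i k.castSucc = N.bot k + 1 ∧ L.height i k.succ = N.bot k + 1 ∧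
    L.height j k.castSucc = N.bot k ∧ L.height j k.succ = N.bot k :=
  Pseudoline.isContact_iff_nat _ _ _

/-- The two pseudolines meeting at a commutator have either a crossing or a contact there. -/
lemma isCrossing_or_isContact {i j : Fin n} {k : Fin m} (hi : L.height i k.castSucc = N.bot k + 1)
    (hj : L.height j k.castSucc = N.bot k) :
    ((L.line i).IsCrossing (L.line j) k ∧ L.height i k.succ = N.bot k ∧
      L.height j k.succ = N.bot k + 1) ∨ (L.line i).IsContact (L.line j) k := by
  have hij : i ≠ j := by rintro rfl; omega
  have h := L.height_ne hij k.succ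
  have h₁ := L.height_step i k
  have h₂ := L.height_step j k
  rw [isCrossing_iff, isContact_iff]
  omega

/-- Two pseudolines are in the order of their labels before their crossing, and in the opposite
order after it. -/
lemma height_lt_iff {i j : Fin n} {k : Fin m} (hk : (L.line i).IsCrossing (L.line j) k)
    (hij : i ≠ j) (t : Fin (m + 1)) :
    L.height i t < L.height j t ↔ (i < j ↔ t ≤ k.castSucc) := by
  have huniq : ∀ l, l ≠ k → ¬ (L.line i).IsCrossing (L.line j) l := fun l hl h =>
    hl ((L.crossing i j hij).unique h hk)
  have hstep : ∀ l, l ≠ k → (L.height i l.castSucc < L.height j l.castSucc ↔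
      L.height i l.succ < L.height j l.succ) := fun l hl =>
    Pseudoline.lt_iff_lt_succ_of_not_isCrossing (L.disjoint i j hij _) (L.disjoint i j hij _)
      (huniq l hl)
  have h0 : ∀ t, t ≤ k.castSucc → (i < j ↔ L.height i t < L.height j t) := by
    intro t ht
    rw [Fin.lt_def, ← L.height_zero i, ← L.height_zero j]
    refine iff_of_forall_step (P := fun t => L.height i t < L.height j t) (Fin.zero_le t)
      fun l _ hl => hstep l ?_
    rintro rfl
    exact absurd (hl.trans ht) (not_le.2 (Fin.castSucc_lt_succ))
  by_cases ht : t ≤ k.castSucc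
  · simp only [ht, iff_true, h0 t ht]
  · have hkt : k.succ ≤ t := Fin.castSucc_lt_iff_succ_le.1 (not_le.1 ht)
    have h1 : L.height i k.succ < L.height j k.succ ↔ L.height i t < L.height j t := by
      refine iff_of_forall_step (P := fun t => L.height i t < L.height j t) hkt
        fun l hl _ => hstep l ?_
      rintro rfl
      exact absurd hl (not_le.2 (Fin.castSucc_lt_succ))
    have h2 : L.height i k.castSucc < L.height j k.castSucc ↔
        L.height j k.succ < L.height i k.succ :=
      Pseudoline.lt_iff_succ_lt_of_isCrossing hk
    have h3 := L.height_ne hij k.succ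
    simp only [ht, iff_false, h0 _ le_rfl, ← h1, h2]
    omega

end Arrangement

namespace Arrangement

variable {L L' : Arrangement N}

/-! ### Flips -/

/-- The permutation of the labels that a flip applies over the interval `t`: it exchanges `i` and `j`
over the intervals lying between the commutators `k` and `k₀`, and is trivial elsewhere. -/
def flipPerm (i j : Fin n) (k k₀ : Fin m) (t : Fin (m + 1)) : Equiv.Perm (Fin n) :=
  if k.castSucc < t ↔ k₀.castSucc < t then 1 else Equiv.swap i j

lemma flipPerm_succ {i j : Fin n} {k k₀ l : Fin m} (h : l ≠ k) (h₀ : l ≠ k₀) :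
    flipPerm i j k k₀ l.succ = flipPerm i j k k₀ l.castSucc := by
  have e : ∀ c : Fin m, l ≠ c → (c.castSucc < l.succ ↔ c.castSucc < l.castSucc) := fun c hc => by
    rw [Fin.ne_iff_vne] at hc
    simp only [Fin.lt_def, Fin.val_castSucc, Fin.val_succ]
    omega
  simp only [flipPerm, e k h, e k₀ h₀]

lemma flipPerm_apply_of_ne {i j x : Fin n} (hi : x ≠ i) (hj : x ≠ j) (k k₀ : Fin m)
    (t : Fin (m + 1)) : flipPerm i j k k₀ t x = x := by
  unfold flipPerm
  split
  · rfl
  · exact Equiv.swap_apply_of_ne_of_ne hi hj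

lemma flipPerm_apply_mem (i j : Fin n) (k k₀ : Fin m) (t : Fin (m + 1)) :
    (flipPerm i j k k₀ t i = i ∧ flipPerm i j k k₀ t j = j) ∨
      (flipPerm i j k k₀ t i = j ∧ flipPerm i j k k₀ t j = i) := by
  unfold flipPerm
  split
  · exact Or.inl ⟨rfl, rfl⟩
  · exact Or.inr ⟨Equiv.swap_apply_left _ _, Equiv.swap_apply_right _ _⟩

/-- At the commutators `k` and `k₀`, exactly one of the two adjacent intervals is exchanged. -/
lemma flipPerm_castSucc_succ {i j : Fin n} {k k₀ : Fin m} (h : k ≠ k₀) (l : Fin m)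
    (hl : l = k ∨ l = k₀) :
    (flipPerm i j k k₀ l.castSucc = 1 ∧ flipPerm i j k k₀ l.succ = Equiv.swap i j) ∨
    (flipPerm i j k k₀ l.castSucc = Equiv.swap i j ∧ flipPerm i j k k₀ l.succ = 1) := by
  have h' := Fin.val_ne_iff.2 h
  unfold flipPerm
  simp only [Fin.lt_def, Fin.val_castSucc, Fin.val_succ]
  rcases hl with rfl | rfl
  · rcases lt_or_gt_of_ne h' with h' | h'
    · left; rw [if_pos, if_neg] <;> first | exact ⟨rfl, rfl⟩ | omega
    · right; rw [if_neg, if_pos] <;> first | exact ⟨rfl, rfl⟩ | omega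
  · rcases lt_or_gt_of_ne h' with h' | h'
    · right; rw [if_neg, if_pos] <;> first | exact ⟨rfl, rfl⟩ | omega
    · left; rw [if_pos, if_neg] <;> first | exact ⟨rfl, rfl⟩ | omega

/-- A contact between two pseudolines can be flipped: exchanging the two pseudolines between the
contact `k` and their crossing `k₀` yields another arrangement. -/
lemma exists_flip_aux {i j : Fin n} {k k₀ : Fin m} (hk : (L.line i).IsContact (L.line j) k)
    (hk₀ : (L.line i).IsCrossing (L.line j) k₀) :
    ∃ L' : Arrangement N, ∀ x t, (L'.line x).level t = (L.line (flipPerm i j k k₀ t x)).level t := by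
  have hij : i ≠ j := by
    rintro rfl
    have := isContact_iff.1 hk
    omega
  have hkk : k ≠ k₀ := by
    rintro rfl
    have := isContact_iff.1 hk
    have := isCrossing_iff.1 hk₀
    omega
  set τ := flipPerm i j k k₀ with hτ
  have hcon := isContact_iff.1 hk
  have hcr := isCrossing_iff.1 hk₀
  -- At `k` and `k₀`, both `i` and `j` have their levels among the two endpoints.
  have hends : ∀ l, l = k ∨ l = k₀ → ∀ t, t = l.castSucc ∨ t = l.succ →
      (L.height i t = N.bot l ∧ L.height j t = N.bot l + 1) ∨
      (L.height i t = N.bot l + 1 ∧ L.height j t = N.bot l) := by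
    intro l hl t ht
    have h1 := L.height_step i k₀
    have h2 := L.height_step j k₀
    have h3 := L.height_ne hij t
    rcases hl with rfl | rfl <;> rcases ht with rfl | rfl <;> omega
  have hstep : ∀ x (l : Fin m), (L.line (τ l.succ x)).level l.succ =
        (L.line (τ l.castSucc x)).level l.castSucc ∨
      ((L.line (τ l.castSucc x)).level l.castSucc = N.bot l ∧
        (L.line (τ l.succ x)).level l.succ = N.top l) ∨
      ((L.line (τ l.castSucc x)).level l.castSucc = N.top l ∧
        (L.line (τ l.succ x)).level l.succ = N.bot l) := by
    intro x l
    by_cases hl : l = k ∨ l = k₀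
    · by_cases hx : x ≠ i ∧ x ≠ j
      · rw [hτ, flipPerm_apply_of_ne hx.1 hx.2, flipPerm_apply_of_ne hx.1 hx.2]
        exact (L.line x).step l
      · have e1 := hends l hl l.castSucc (Or.inl rfl)
        have e2 := hends l hl l.succ (Or.inr rfl)
        have hx' : x = i ∨ x = j := by tauto
        simp only [Fin.ext_iff, N.top_eq]
        change L.height (τ l.succ x) l.succ = L.height (τ l.castSucc x) l.castSucc ∨
          (L.height (τ l.castSucc x) l.castSucc = _ ∧ L.height (τ l.succ x) l.succ = _) ∨
          (L.height (τ l.castSucc x) l.castSucc = _ ∧ L.height (τ l.succ x) l.succ = _)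
        rcases hx' with rfl | rfl
        · rcases flipPerm_apply_mem x j k k₀ l.succ with ⟨a, -⟩ | ⟨a, -⟩ <;>
          rcases flipPerm_apply_mem x j k k₀ l.castSucc with ⟨b, -⟩ | ⟨b, -⟩ <;>
          rw [hτ, a, b] <;> omega
        · rcases flipPerm_apply_mem i x k k₀ l.succ with ⟨-, a⟩ | ⟨-, a⟩ <;>
          rcases flipPerm_apply_mem i x k k₀ l.castSucc with ⟨-, b⟩ | ⟨-, b⟩ <;>
          rw [hτ, a, b] <;> omega
    · rw [not_or] at hl
      rw [hτ, flipPerm_succ hl.1 hl.2]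
      exact (L.line _).step l
  let P : Fin n → Pseudoline N := fun x => ⟨fun t => (L.line (τ t x)).level t, hstep x⟩
  have hP : ∀ x t, ((P x).level t : ℕ) = L.height (τ t x) t := fun _ _ => rfl
  have hdisj : ∀ x y, x ≠ y → ∀ t, (P x).level t ≠ (P y).level t := fun x y hxy t =>
    L.disjoint _ _ (fun h => hxy ((τ t).injective h)) t
  have hτ0 : τ 0 = 1 := by simp [hτ, flipPerm]
  have hτl : τ (Fin.last m) = 1 := by simp [hτ, flipPerm, Fin.castSucc_lt_last]
  -- Two exchanged pseudolines end in the opposite order, so they cross.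
  have hex : ∀ x y, x ≠ y → ∃ l, (P x).IsCrossing (P y) l := by
    intro x y hxy
    by_contra! hno
    obtain ⟨c, hc, -⟩ := L.crossing x y hxy
    have h : (P x).level 0 < (P y).level 0 ↔ (P x).level (Fin.last m) < (P y).level (Fin.last m) :=
      iff_of_forall_step (P := fun t => (P x).level t < (P y).level t) (Fin.zero_le _) fun l _ _ =>
        Pseudoline.lt_iff_lt_succ_of_not_isCrossing (hdisj x y hxy _) (hdisj x y hxy _) (hno l)
    rw [Fin.lt_def, Fin.lt_def, hP, hP, hP, hP, hτ0, hτl] at h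
    change L.height x 0 < L.height y 0 ↔ L.height x _ < L.height y _ at h
    rw [height_lt_iff hc hxy, height_lt_iff hc hxy] at h
    have := Fin.castSucc_lt_last c
    simp only [Fin.zero_le, iff_true, not_le.2 this, iff_false, not_lt] at h
    exact iff_not_self (h.trans not_lt.symm)
  -- Away from `k` and `k₀`, the crossings of `P` are crossings of `L`, with exchanged labels.
  have htrav : ∀ x l, l ≠ k → l ≠ k₀ → (P x).Traverses l →
      (L.line (τ l.castSucc x)).Traverses l := by
    intro x l h1 h2 h
    change (L.line (τ l.castSucc x)).level l.castSucc ≠ (L.line (τ l.succ x)).level l.succ at h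
    rwa [hτ, flipPerm_succ h1 h2] at h
  have hend : ∀ x l, (P x).Traverses l → ((P x).level l.castSucc : ℕ) = N.bot l ∨
      ((P x).level l.castSucc : ℕ) = N.bot l + 1 := by
    intro x l h
    rw [Pseudoline.traverses_iff_nat] at h
    have := (P x).step_nat l
    omega
  have hthree : ∀ x y z l, x ≠ y → y ≠ z → x ≠ z → (P x).Traverses l → (P y).Traverses l →
      ¬ (P z).Traverses l := by
    intro x y z l h1 h2 h3 hx hy hz
    have := Fin.val_ne_iff.2 (hdisj x y h1 l.castSucc)
    have := Fin.val_ne_iff.2 (hdisj y z h2 l.castSucc)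
    have := Fin.val_ne_iff.2 (hdisj x z h3 l.castSucc)
    have := hend x l hx
    have := hend y l hy
    have := hend z l hz
    omega
  have hout : ∀ x l, x ≠ i → x ≠ j → (P x).Traverses l → l ≠ k ∧ l ≠ k₀ := by
    intro x l hi hj hx
    by_contra hl
    have hl' : l = k ∨ l = k₀ := by tauto
    have e1 := hends l hl' l.castSucc (Or.inl rfl)
    have e2 := hend x l hx
    rw [hP, hτ, flipPerm_apply_of_ne hi hj] at e2
    have := L.height_ne hi l.castSucc
    have := L.height_ne hj l.castSucc
    omega
  have hout' : ¬ (P i).Traverses k₀ := by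
    rw [Pseudoline.traverses_iff_nat, hP, hP]
    have h1 := L.height_step i k₀
    have h2 := L.height_step j k₀
    have h3 := L.height_ne hij k₀.castSucc
    have h4 := L.height_ne hij k₀.succ
    rcases flipPerm_castSucc_succ (i := i) (j := j) hkk k₀ (Or.inr rfl) with ⟨a, b⟩ | ⟨a, b⟩ <;>
      rw [hτ, a, b] <;> simp only [Equiv.swap_apply_left, Equiv.Perm.one_apply] <;> omega
  have hcross_out : ∀ x y l, x ≠ i → x ≠ j → y = i ∨ y = j → (P x).IsCrossing (P y) l →
      (L.line x).IsCrossing (L.line i) l ∨ (L.line x).IsCrossing (L.line j) l := by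
    intro x y l hi hj hy hl
    obtain ⟨h1, h2⟩ := hout x l hi hj hl.1
    have hx := htrav x l h1 h2 hl.1
    have hy' := htrav y l h1 h2 hl.2
    rw [hτ, flipPerm_apply_of_ne hi hj] at hx
    rcases flipPerm_apply_mem i j k k₀ l.castSucc with ⟨a, b⟩ | ⟨a, b⟩ <;> rcases hy with rfl | rfl
    · rw [hτ, a] at hy'; exact Or.inl ⟨hx, hy'⟩
    · rw [hτ, b] at hy'; exact Or.inr ⟨hx, hy'⟩
    · rw [hτ, a] at hy'; exact Or.inr ⟨hx, hy'⟩
    · rw [hτ, b] at hy'; exact Or.inl ⟨hx, hy'⟩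
  -- A third pseudoline crosses `i` and `j` once each in `L`; in `P` it still crosses each of them at
  -- least once, and these crossings are at the same two commutators.
  have huniq_out : ∀ x y l l', x ≠ i → x ≠ j → y = i ∨ y = j → (P x).IsCrossing (P y) l →
      (P x).IsCrossing (P y) l' → l = l' := by
    intro x y l l' hi hj hy hl hl'
    obtain ⟨z, hz, hyz⟩ : ∃ z, (z = i ∨ z = j) ∧ y ≠ z := by
      rcases hy with rfl | rfl
      · exact ⟨j, Or.inr rfl, hij⟩
      · exact ⟨i, Or.inl rfl, hij.symm⟩
    have hxy : x ≠ y := by rcases hy with rfl | rfl <;> assumption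
    have hxz : x ≠ z := by rcases hz with rfl | rfl <;> assumption
    obtain ⟨l'', hl''⟩ := hex x z hxz
    have n1 : l ≠ l'' := by rintro rfl; exact hthree x y z l hxy hyz hxz hl.1 hl.2 hl''.2
    have n2 : l' ≠ l'' := by rintro rfl; exact hthree x y z l' hxy hyz hxz hl'.1 hl'.2 hl''.2
    have u1 := fun a b => (L.crossing x i hi).unique (y₁ := a) (y₂ := b)
    have u2 := fun a b => (L.crossing x j hj).unique (y₁ := a) (y₂ := b)
    rcases hcross_out x y l hi hj hy hl with c1 | c1 <;>
    rcases hcross_out x y l' hi hj hy hl' with c2 | c2 <;>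
    rcases hcross_out x z l'' hi hj hz hl'' with c3 | c3
    · exact u1 _ _ c1 c2
    · exact u1 _ _ c1 c2
    · exact absurd (u1 _ _ c1 c3) n1
    · exact absurd (u2 _ _ c2 c3) n2
    · exact absurd (u1 _ _ c2 c3) n2
    · exact absurd (u2 _ _ c1 c3) n1
    · exact u2 _ _ c1 c2
    · exact u2 _ _ c1 c2
  have hpair : ∀ l, (P i).IsCrossing (P j) l → l = k := by
    intro l hl
    by_contra hlk
    have hl0 : l ≠ k₀ := by rintro rfl; exact hout' hl.1
    have hi := htrav i l hlk hl0 hl.1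
    have hj := htrav j l hlk hl0 hl.2
    rcases flipPerm_apply_mem i j k k₀ l.castSucc with ⟨a, b⟩ | ⟨a, b⟩ <;> rw [hτ, a] at hi <;>
      rw [hτ, b] at hj
    · exact hl0 ((L.crossing i j hij).unique ⟨hi, hj⟩ hk₀)
    · exact hl0 ((L.crossing i j hij).unique ⟨hj, hi⟩ hk₀)
  refine ⟨⟨P, fun x => ?_, fun x y hxy => ?_, hdisj⟩, fun x t => rfl⟩
  · change (L.line (τ 0 x)).level 0 = x
    rw [hτ0]
    exact L.start x
  · obtain ⟨l, hl⟩ := hex x y hxy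
    refine ⟨l, hl, fun l' hl' => ?_⟩
    by_cases hx : x = i ∨ x = j <;> by_cases hy : y = i ∨ y = j
    · have key : ∀ c, (P x).IsCrossing (P y) c → c = k := by
        intro c hc
        rcases hx with rfl | rfl <;> rcases hy with rfl | rfl
        · exact absurd rfl hxy
        · exact hpair c hc
        · exact hpair c hc.symm
        · exact absurd rfl hxy
      rw [key l hl, key l' hl']
    · rw [not_or] at hy
      exact huniq_out y x l' l hy.1 hy.2 hx hl'.symm hl.symm
    · rw [not_or] at hx
      exact huniq_out x y l' l hx.1 hx.2 hy hl' hl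
    · rw [not_or] at hx hy
      have key : ∀ c, (P x).IsCrossing (P y) c → (L.line x).IsCrossing (L.line y) c := by
        intro c hc
        obtain ⟨h1, h2⟩ := hout x c hx.1 hx.2 hc.1
        have e1 := htrav x c h1 h2 hc.1
        have e2 := htrav y c h1 h2 hc.2
        rw [hτ, flipPerm_apply_of_ne hx.1 hx.2] at e1
        rw [hτ, flipPerm_apply_of_ne hy.1 hy.2] at e2
        exact ⟨e1, e2⟩
      exact (L.crossing x y hxy).unique (key _ hl') (key _ hl)

end Arrangement

/-! ### Brick vectors and flips -/

/-- Over the interval of abscissae covered by a brick, a pseudoline stays on the same side of it. -/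
lemma Pseudoline.isAboveBrick_iff (p : Pseudoline N) {b : Fin m × Fin m} (hb : b ∈ N.bricks)
    {t : Fin (m + 1)} (h₁ : b.1.succ ≤ t) (h₂ : t ≤ b.2.castSucc) :
    p.IsAboveBrick b ↔ N.top b.1 ≤ p.level t := by
  have key : ∀ s, b.1.succ ≤ s → s ≤ b.2.castSucc →
      (N.top b.1 ≤ p.level b.1.succ ↔ N.top b.1 ≤ p.level s) := by
    intro s hs hs'
    refine iff_of_forall_step (P := fun t => N.top b.1 ≤ p.level t) hs fun k hk hk' => ?_
    have hne := Fin.val_ne_iff.2 <| hb.2.2 k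
      (Fin.castSucc_lt_castSucc_iff.1 (Fin.castSucc_lt_iff_succ_le.2 hk))
      (Fin.castSucc_lt_castSucc_iff.1 (Fin.castSucc_lt_iff_succ_le.2 (hk'.trans hs')))
    have := p.step_nat k
    rw [Fin.le_def, Fin.le_def, N.top_eq]
    omega
  refine ⟨fun h => h t (Fin.castSucc_lt_iff_succ_le.2 h₁) h₂, fun h s hs hs' => ?_⟩
  exact (key s (Fin.castSucc_lt_iff_succ_le.1 hs) hs').1 ((key t h₁ h₂).2 h)

lemma Network.brick_succ_le {b : Fin m × Fin m} (hb : b ∈ N.bricks) : b.1.succ ≤ b.2.castSucc :=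
  Fin.castSucc_lt_iff_succ_le.1 (Fin.castSucc_lt_castSucc_iff.2 hb.1)

namespace Arrangement

variable {L L' : Arrangement N}

/-- The bricks below a pseudoline can be recognized on the first interval of abscissae that they cover. -/
lemma brickVector_apply (L : Arrangement N) (i : Fin n) :
    L.brickVector i = ∑ b ∈ (Set.toFinite N.bricks).toFinset,
      if N.top b.1 ≤ (L.line i).level b.1.succ then (1 : ℝ) else 0 := by
  rw [← Finset.sum_filter, Finset.sum_const, nsmul_eq_mul, mul_one, brickVector,
    ← Set.ncard_coe_finset]
  congr 2
  ext b
  simp only [Finset.coe_filter, Set.Finite.mem_toFinset, Set.mem_ofPred_eq]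
  exact and_congr_right fun hb => (L.line i).isAboveBrick_iff hb le_rfl (Network.brick_succ_le hb)

/-- Some brick lies between the pseudolines `i` and `j`, in the region that they bound between their
contact `k` and their crossing `k₀`: the one next to `k`, on the levels of `k` and on the side of
`k₀`. It makes the move of the brick vector under a flip nonzero. -/
lemma exists_brick_between {i j : Fin n} {k k₀ : Fin m} (hk : (L.line i).IsContact (L.line j) k)
    (hk₀ : (L.line i).IsCrossing (L.line j) k₀) :
    ∃ b ∈ N.bricks, (k.castSucc < b.1.succ ↔ ¬ k₀.castSucc < b.1.succ) ∧
      N.top b.1 ≤ (L.line i).level b.1.succ ∧ ¬ N.top b.1 ≤ (L.line j).level b.1.succ := by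
  have hcon := isContact_iff.1 hk
  have hcr := isCrossing_iff.1 hk₀
  have hij : i ≠ j := by rintro rfl; omega
  have hkk : k ≠ k₀ := by rintro rfl; omega
  have hpass : ∀ l, N.bot l ≠ N.bot k → ∀ x,
      (N.top k ≤ (L.line x).level l.castSucc ↔ N.top k ≤ (L.line x).level l.succ) := by
    intro l hl x
    have := Fin.val_ne_iff.2 hl
    have := (L.line x).step_nat l
    rw [Fin.le_def, Fin.le_def, N.top_eq]
    omega
  have hi : ∀ t, (t = k.castSucc ∨ t = k.succ) → N.top k ≤ (L.line i).level t := by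
    intro t ht
    rw [Fin.le_def, N.top_eq]
    change _ ≤ L.height i t
    rcases ht with rfl | rfl <;> omega
  have hj : ∀ t, (t = k.castSucc ∨ t = k.succ) → ¬ N.top k ≤ (L.line j).level t := by
    intro t ht
    rw [Fin.le_def, N.top_eq]
    change ¬ _ ≤ L.height j t
    rcases ht with rfl | rfl <;> omega
  -- Next to `k₀`, the two pseudolines are on consecutive levels, so if these levels are separated by
  -- the gap of `k`, then they are the levels of `k`.
  have hsep : ∀ t, (t = k₀.castSucc ∨ t = k₀.succ) → N.top k ≤ (L.line i).level t →
      ¬ N.top k ≤ (L.line j).level t → N.bot k₀ = N.bot k := by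
    intro t ht h1 h2
    rw [Fin.le_def, N.top_eq] at h1 h2
    change _ ≤ L.height i t at h1
    change ¬ _ ≤ L.height j t at h2
    have e1 := L.height_step i k₀
    have e2 := L.height_step j k₀
    rw [Fin.ext_iff]
    rcases ht with rfl | rfl <;> omega
  rcases lt_or_gt_of_ne hkk with hlt | hlt
  · obtain ⟨l, ⟨hl1, hl2, hl3⟩, hmin⟩ : ∃ l, (k < l ∧ l ≤ k₀ ∧ N.bot l = N.bot k) ∧
        ∀ l', k < l' → l' < l → N.bot l' ≠ N.bot k := by
      have hne : ∃ l, k < l ∧ l ≤ k₀ ∧ N.bot l = N.bot k := by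
        by_contra! hno
        refine hno k₀ hlt le_rfl ?_
        have hle : k.succ ≤ k₀.castSucc :=
          Fin.castSucc_lt_iff_succ_le.1 (Fin.castSucc_lt_castSucc_iff.2 hlt)
        have hx : ∀ x, N.top k ≤ (L.line x).level k.succ ↔ N.top k ≤ (L.line x).level k₀.castSucc :=
          fun x => iff_of_forall_step (P := fun t => N.top k ≤ (L.line x).level t) hle
            fun l h1 h2 => hpass l (hno l
              (Fin.castSucc_lt_castSucc_iff.1 (Fin.castSucc_lt_iff_succ_le.2 h1))
              (Fin.castSucc_lt_castSucc_iff.1 (Fin.castSucc_lt_iff_succ_le.2 h2)).le) x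
        exact hsep _ (Or.inl rfl) ((hx i).1 (hi _ (Or.inr rfl)))
          (mt (hx j).2 (hj _ (Or.inr rfl)))
      obtain ⟨l, hl, hmin⟩ := WellFounded.has_min (wellFounded_lt (α := Fin m))
        {l | k < l ∧ l ≤ k₀ ∧ N.bot l = N.bot k} hne
      exact ⟨l, hl, fun l' h1 h2 h3 => hmin l' ⟨h1, h2.le.trans hl.2.1, h3⟩ h2⟩
    refine ⟨(k, l), ⟨hl1, hl3.symm, hmin⟩, ?_, hi _ (Or.inr rfl), hj _ (Or.inr rfl)⟩
    simp only [Fin.castSucc_lt_succ_iff, le_refl, not_le, true_iff]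
    exact hlt
  · obtain ⟨l, ⟨hl1, hl2, hl3⟩, hmax⟩ : ∃ l, (l < k ∧ k₀ ≤ l ∧ N.bot l = N.bot k) ∧
        ∀ l', l < l' → l' < k → N.bot l' ≠ N.bot k := by
      have hne : ∃ l, l < k ∧ k₀ ≤ l ∧ N.bot l = N.bot k := by
        by_contra! hno
        refine hno k₀ hlt le_rfl ?_
        have hle : k₀.succ ≤ k.castSucc :=
          Fin.castSucc_lt_iff_succ_le.1 (Fin.castSucc_lt_castSucc_iff.2 hlt)
        have hx : ∀ x, N.top k ≤ (L.line x).level k₀.succ ↔ N.top k ≤ (L.line x).level k.castSucc :=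
          fun x => iff_of_forall_step (P := fun t => N.top k ≤ (L.line x).level t) hle
            fun l h1 h2 => hpass l (hno l
              (Fin.castSucc_lt_castSucc_iff.1 (Fin.castSucc_lt_iff_succ_le.2 h2))
              (Fin.castSucc_lt_castSucc_iff.1 (Fin.castSucc_lt_iff_succ_le.2 h1)).le) x
        exact hsep _ (Or.inr rfl) ((hx i).2 (hi _ (Or.inl rfl)))
          (mt (hx j).1 (hj _ (Or.inl rfl)))
      obtain ⟨l, hl, hmax⟩ := WellFounded.has_min (wellFounded_gt (α := Fin m))
        {l | l < k ∧ k₀ ≤ l ∧ N.bot l = N.bot k} hne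
      exact ⟨l, hl, fun l' h1 h2 h3 => hmax l' ⟨h2, hl.2.1.trans h1.le, h3⟩ h1⟩
    have hb : (l, k) ∈ N.bricks := ⟨hl1, hl3, fun c h1 h2 => hl3 ▸ hmax c h1 h2⟩
    refine ⟨(l, k), hb, ?_, ?_, ?_⟩
    · simp only [Fin.castSucc_lt_succ_iff, hl2, not_true, iff_false, not_le]
      exact hl1
    all_goals
      rw [← Pseudoline.isAboveBrick_iff _ hb le_rfl (Network.brick_succ_le hb),
        Pseudoline.isAboveBrick_iff _ hb (Network.brick_succ_le hb) le_rfl]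
      have : N.top l = N.top k := Fin.ext (by rw [N.top_eq, N.top_eq, hl3])
      simp only [this]
    · exact hi _ (Or.inl rfl)
    · exact hj _ (Or.inl rfl)

/-- Flipping a contact between `i` (above) and `j` (below) moves the brick vector by a positive
multiple of `e_j - e_i`, and exchanges the labels `i` and `j` over some of the intervals. -/
theorem exists_flip {i j : Fin n} {k : Fin m} (hk : (L.line i).IsContact (L.line j) k) :
    ∃ (L' : Arrangement N) (c : ℝ), 0 < c ∧
      L'.brickVector - L.brickVector = c • (Pi.single j 1 - Pi.single i 1) ∧
      ∀ t, ∃ σ ∈ ({1, Equiv.swap i j} : Set (Equiv.Perm (Fin n))),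
        ∀ x, (L'.line x).level t = (L.line (σ x)).level t := by
  have hcon := isContact_iff.1 hk
  have hij : i ≠ j := by rintro rfl; omega
  obtain ⟨k₀, hk₀, -⟩ := L.crossing i j hij
  obtain ⟨L', hL'⟩ := exists_flip_aux hk hk₀
  -- Between `k` and `k₀`, the pseudoline `i` runs above `j`, as it does at `k`.
  have hlt : ∀ t, (k.castSucc < t ↔ ¬ k₀.castSucc < t) → L.height j t < L.height i t := by
    intro t ht
    have h1 := height_lt_iff hk₀ hij k.castSucc
    have h2 := height_lt_iff hk₀ hij k.succ
    have h3 := height_lt_iff hk₀ hij t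
    have h4 := L.height_ne hij t
    have hi : ¬ L.height i k.castSucc < L.height j k.castSucc := by omega
    have hi' : ¬ L.height i k.succ < L.height j k.succ := by omega
    have : ¬ L.height i t < L.height j t := by
      simp only [Fin.lt_def, Fin.le_def, Fin.val_castSucc, Fin.val_succ] at *
      omega
    omega
  have hle : ∀ t, (L'.line i).level t ≤ (L.line i).level t := by
    intro t
    rw [hL']
    unfold flipPerm
    split_ifs with h
    · rfl
    · rw [Equiv.swap_apply_left]
      exact (hlt t (by tauto)).le
  have hsum : L'.brickVector i + L'.brickVector j = L.brickVector i + L.brickVector j := by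
    simp only [brickVector_apply, ← Finset.sum_add_distrib, hL']
    refine Finset.sum_congr rfl fun b _ => ?_
    rcases flipPerm_apply_mem i j k k₀ b.1.succ with ⟨h, h'⟩ | ⟨h, h'⟩
    · rw [h, h']
    · rw [h, h', add_comm]
  have hdec : L'.brickVector i < L.brickVector i := by
    obtain ⟨b, hb, hbt, hbi, hbj⟩ := exists_brick_between hk hk₀
    rw [brickVector_apply, brickVector_apply]
    refine Finset.sum_lt_sum (fun b _ => ?_) ⟨b, by simpa using hb, ?_⟩
    · split_ifs with h h'
      · rfl
      · exact absurd (h.trans (hle _)) h'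
      · exact zero_le_one
      · rfl
    · have : flipPerm i j k k₀ b.1.succ i = j := by
        rw [flipPerm, if_neg (by tauto), Equiv.swap_apply_left]
      rw [hL', this, if_pos hbi, if_neg hbj]
      exact zero_lt_one
  refine ⟨L', L.brickVector i - L'.brickVector i, sub_pos.2 hdec, ?_, fun t => ?_⟩
  · funext x
    simp only [Pi.sub_apply, Pi.smul_apply, smul_eq_mul]
    by_cases hxi : x = i
    · subst hxi
      rw [Pi.single_eq_same, Pi.single_eq_of_ne hij]
      ring
    · by_cases hxj : x = j
      · subst hxj
        rw [Pi.single_eq_same, Pi.single_eq_of_ne hxi]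
        linarith
      · rw [Pi.single_eq_of_ne hxi, Pi.single_eq_of_ne hxj, brickVector_apply, brickVector_apply]
        simp only [hL', flipPerm_apply_of_ne hxi hxj]
        ring
  · refine ⟨flipPerm i j k k₀ t, ?_, fun x => hL' x t⟩
    unfold flipPerm
    split_ifs <;> simp

end Arrangement

namespace Arrangement

variable {L L' L'' : Arrangement N} {f g : Fin n → ℝ}

/-! ### Compatible functionals and colorings -/

/-- The functional `f` is nonnegative on the incidence cone of the contact graph of `L`: it does not
decrease along the arcs. -/
def IsCompatible (L : Arrangement N) (f : Fin n → ℝ) : Prop :=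
  ∀ k i j, (L.line i).IsContact (L.line j) k → f i ≤ f j

/-- When the pseudolines are colored by `f`, the two arrangements show the same color on each level
over each interval. -/
def SameColoring (f : Fin n → ℝ) (L L' : Arrangement N) : Prop :=
  ∀ t x y, L.height x t = L'.height y t → f x = f y

namespace SameColoring

lemma refl (L : Arrangement N) : SameColoring f L L := fun _ _ _ h =>
  congrArg f (L.eq_of_height_eq h)

lemma symm (h : SameColoring f L L') : SameColoring f L' L := fun t x y e => (h t y x e.symm).symm

lemma trans (h : SameColoring f L L') (h' : SameColoring f L' L'') : SameColoring f L L'' := by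
  intro t x y e
  obtain ⟨z, hz⟩ := L'.exists_height_eq t ((L.line x).level t)
  exact (h t x z hz.symm).trans (h' t z y (hz.trans e))

/-- The value of `f` on the brick vector only depends on the coloring: it is obtained by summing, over
all bricks, the colors of the levels above. -/
lemma dotProduct_brickVector_eq (h : SameColoring f L L') :
    f ⬝ᵥ L.brickVector = f ⬝ᵥ L'.brickVector := by
  simp only [dotProduct, brickVector_apply, Finset.mul_sum]
  rw [Finset.sum_comm, Finset.sum_comm (s := Finset.univ)]
  refine Finset.sum_congr rfl fun b _ => ?_
  let e := (L.levelEquiv b.1.succ).trans (L'.levelEquiv b.1.succ).symm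
  have he : ∀ x, (L'.line (e x)).level b.1.succ = (L.line x).level b.1.succ := fun x =>
    (L'.levelEquiv b.1.succ).apply_symm_apply _
  refine Fintype.sum_equiv e _ _ fun x => ?_
  rw [he, h b.1.succ x (e x) (congrArg Fin.val (he x)).symm]

/-- Compatibility only depends on the coloring: a contact of `L'` is, in `L`, either a contact with the
same colors, or a crossing, and then both levels keep their colors only if these are equal. -/
lemma isCompatible (h : SameColoring f L L') (hL : L.IsCompatible f) : L'.IsCompatible f := by
  intro k i j hk
  rw [isContact_iff] at hk
  obtain ⟨x, hx⟩ := L.exists_height_eq k.castSucc ((L'.line i).level k.castSucc)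
  obtain ⟨y, hy⟩ := L.exists_height_eq k.castSucc ((L'.line j).level k.castSucc)
  change _ = L'.height _ _ at hx hy
  have hxi := h _ x i hx
  have hyj := h _ y j hy
  rcases isCrossing_or_isContact (hx.trans hk.1) (hy.trans hk.2.2.1) with ⟨-, -, h2⟩ | hc
  · rw [← h k.succ y i (h2.trans hk.2.1.symm), hyj]
  · rw [← hxi, ← hyj]
    exact hL k x y hc

end SameColoring

/-- A flip improves a functional that decreases along the flipped arc, and preserves the colorings in
which the two pseudolines have the same color. -/
lemma exists_flip_dotProduct {i j : Fin n} {k : Fin m} (hk : (L.line i).IsContact (L.line j) k) :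
    ∃ L' : Arrangement N, (∀ f, f i = f j → SameColoring f L L') ∧
      (∀ f, f j ≤ f i → f ⬝ᵥ L'.brickVector ≤ f ⬝ᵥ L.brickVector) ∧
      (∀ f, f j < f i → f ⬝ᵥ L'.brickVector < f ⬝ᵥ L.brickVector) := by
  obtain ⟨L', c, hc, hv, hperm⟩ := exists_flip hk
  have hval : ∀ f : Fin n → ℝ, f ⬝ᵥ L'.brickVector = f ⬝ᵥ L.brickVector + c * (f j - f i) := by
    intro f
    rw [← sub_eq_iff_eq_add', ← dotProduct_sub, hv, dotProduct_smul, dotProduct_sub,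
      dotProduct_single, dotProduct_single]
    simp
  refine ⟨L', fun f hf t x y hxy => ?_, fun f hf => ?_, fun f hf => ?_⟩
  · obtain ⟨σ, hσ, hσ'⟩ := hperm t
    have hx : x = σ y := L.eq_of_height_eq (hxy.trans (congrArg Fin.val (hσ' y)))
    rcases hσ with rfl | rfl
    · rw [hx]; rfl
    · rw [hx, Equiv.swap_apply_def]
      split_ifs with h1 h2
      · rw [h1, hf]
      · rw [h2, hf]
      · rfl
  · rw [hval]
    nlinarith
  · rw [hval]
    nlinarith

/-- A compatibility with `f` can be refined to a compatibility with a functional `g` breaking the ties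
of `f`, without changing the coloring by `f`: minimize `g` among the arrangements with this coloring. -/
lemma exists_sameColoring_isCompatible (hL : L.IsCompatible f) (hfg : ∀ i j, f i < f j → g i < g j) :
    ∃ L', SameColoring f L L' ∧ L'.IsCompatible g := by
  obtain ⟨M, hM, hmin⟩ := Set.exists_min_image {M | SameColoring f L M}
    (fun M => g ⬝ᵥ M.brickVector) (Set.toFinite _) ⟨L, .refl L⟩
  refine ⟨M, hM, fun k i j hk => ?_⟩
  by_contra! hlt
  have hf : f i = f j := by
    refine le_antisymm (SameColoring.isCompatible hM hL k i j hk) (not_lt.1 fun h => ?_)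
    exact hlt.not_gt (hfg i j h)
  obtain ⟨M', h1, -, h3⟩ := exists_flip_dotProduct hk
  exact (h3 g hlt).not_ge (hmin M' (SameColoring.trans hM (h1 f hf)))

/-! ### Uniqueness of the arrangement compatible with a linear order -/

/-- Two distinct arrangements coincide up to some commutator at which two pseudolines cross in one
of the arrangements and are in contact, before their crossing, in the other one. -/
lemma exists_first_difference {L₁ L₂ : Arrangement N} (h : L₁ ≠ L₂) :
    ∃ L L' : Arrangement N, (L = L₁ ∧ L' = L₂ ∨ L = L₂ ∧ L' = L₁) ∧
      ∃ k i j, i < j ∧ (∀ t ≤ k.castSucc, ∀ x, L.height x t = L'.height x t) ∧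
        (L.line i).IsCrossing (L.line j) k ∧ (L'.line j).IsContact (L'.line i) k := by
  have hne : {t | ∃ x, L₁.height x t ≠ L₂.height x t}.Nonempty := by
    by_contra hno
    refine h (ext_height fun i t => ?_)
    by_contra hit
    exact hno ⟨t, i, hit⟩
  obtain ⟨t, ⟨x, hx⟩, hmin⟩ := WellFounded.has_min (wellFounded_lt (α := Fin (m + 1))) _ hne
  have hagree : ∀ s < t, ∀ y, L₁.height y s = L₂.height y s := fun s hs y => by
    by_contra hy
    exact hmin s ⟨y, hy⟩ hs
  induction t using Fin.cases with
  | zero => exact absurd ((L₁.height_zero x).trans (L₂.height_zero x).symm) hx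
  | succ k =>
    have hagree' : ∀ t ≤ k.castSucc, ∀ y, L₁.height y t = L₂.height y t := fun t ht =>
      hagree t (ht.trans_lt (Fin.castSucc_lt_succ))
    obtain ⟨j, hj⟩ := L₁.exists_height_eq k.castSucc (N.top k)
    obtain ⟨i, hi⟩ := L₁.exists_height_eq k.castSucc (N.bot k)
    rw [N.top_eq] at hj
    have hij : i ≠ j := by rintro rfl; omega
    have hj' := (hagree' _ le_rfl j) ▸ hj
    have hi' := (hagree' _ le_rfl i) ▸ hi
    have hlt : ∀ {L : Arrangement N}, L.height i k.castSucc = N.bot k →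
        L.height j k.castSucc = N.bot k + 1 → (L.line j).IsCrossing (L.line i) k → i < j := by
      intro L h1 h2 hc
      have := (height_lt_iff (And.symm hc : (L.line i).IsCrossing (L.line j) k) hij
        k.castSucc).1 (by omega)
      exact this.2 le_rfl
    have hxij : L₁.height x k.castSucc = L₂.height x k.castSucc := hagree' _ le_rfl x
    have s1 := L₁.height_step x k
    have s2 := L₂.height_step x k
    have hx' : x = i ∨ x = j := by
      by_contra! hx'
      have := L₁.height_ne hx'.1 k.castSucc
      have := L₁.height_ne hx'.2 k.castSucc
      omega
    rcases isCrossing_or_isContact hj hi with ⟨c1, c1', c1''⟩ | c1 <;>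
      rcases isCrossing_or_isContact hj' hi' with ⟨c2, c2', c2''⟩ | c2
    · rcases hx' with rfl | rfl <;> omega
    · exact ⟨L₁, L₂, Or.inl ⟨rfl, rfl⟩, k, i, j, hlt hi hj c1, hagree', And.symm c1, c2⟩
    · exact ⟨L₂, L₁, Or.inr ⟨rfl, rfl⟩, k, i, j, hlt hi' hj' c2,
        fun t ht y => (hagree' t ht y).symm, And.symm c2, c1⟩
    · rw [isContact_iff] at c1 c2
      rcases hx' with rfl | rfl <;> omega

/-- If the arrangements have the same coloring, in which only two pseudolines share a color, and are
both compatible with an injective `g`, then they are equal: at the first difference, these two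
pseudolines cross in one arrangement and are in contact in the other, where they cross later on; at
this later crossing, the former arrangement has a contact, in the opposite direction. -/
lemma eq_of_sameColoring (hg : Function.Injective g)
    (hf : ∀ x y z, f x = f y → f y = f z → x = y ∨ y = z ∨ x = z) {L₁ L₂ : Arrangement N}
    (h₁ : L₁.IsCompatible g) (h₂ : L₂.IsCompatible g) (h : SameColoring f L₁ L₂) : L₁ = L₂ := by
  by_contra hne
  obtain ⟨L, L', hLL, k, i, j, hij, hagree, hcr, hct⟩ := exists_first_difference hne
  obtain ⟨hL, hL', hs⟩ : L.IsCompatible g ∧ L'.IsCompatible g ∧ SameColoring f L L' := by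
    rcases hLL with ⟨rfl, rfl⟩ | ⟨rfl, rfl⟩
    exacts [⟨h₁, h₂, h⟩, ⟨h₂, h₁, h.symm⟩]
  have hct' := isContact_iff.1 hct
  have hcr' := isCrossing_iff.1 hcr
  have hi := hagree _ le_rfl i
  have hj := hagree _ le_rfl j
  have si := L.height_step i k
  have hfij : f i = f j := hs k.succ i j (by omega)
  obtain ⟨k', hk', -⟩ := L'.crossing i j hij.ne
  have hkk : k' ≠ k := by
    rintro rfl
    have := isCrossing_iff.1 hk'
    omega
  have hlt : k < k' := by
    by_contra hlt
    have hle : k'.succ ≤ k.castSucc := Fin.castSucc_lt_iff_succ_le.1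
      (Fin.castSucc_lt_castSucc_iff.2 (lt_of_le_of_ne (not_lt.1 hlt) hkk))
    have hle' : k'.castSucc ≤ k.castSucc := (Fin.castSucc_lt_succ).le.trans hle
    have : (L.line i).IsCrossing (L.line j) k' := by
      rw [isCrossing_iff] at hk' ⊢
      rwa [hagree _ hle, hagree _ hle, hagree _ hle', hagree _ hle']
    exact hkk ((L.crossing i j hij.ne).unique this hcr)
  have ho' := (height_lt_iff hk' hij.ne k'.castSucc).2 (by simp [hij])
  have ho : ¬ L.height i k'.castSucc < L.height j k'.castSucc := by
    rw [height_lt_iff hcr hij.ne]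
    simp [hij, hlt]
  have hi' := L'.height_step i k'
  have hj' := L'.height_step j k'
  have hk'' := isCrossing_iff.1 hk'
  have hne' := L'.height_ne hij.ne k'.succ
  obtain ⟨x, hx⟩ := L.exists_height_eq k'.castSucc ((L'.line i).level k'.castSucc)
  obtain ⟨y, hy⟩ := L.exists_height_eq k'.castSucc ((L'.line j).level k'.castSucc)
  change _ = L'.height _ _ at hx hy
  have hxy : x ≠ y := by rintro rfl; omega
  have hmem : ∀ z, f z = f i → z = i ∨ z = j := fun z hz => by
    rcases hf z i j hz hfij with h | h | h
    exacts [Or.inl h, absurd h hij.ne, Or.inr h]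
  obtain ⟨rfl, rfl⟩ : x = j ∧ y = i := by
    rcases hmem x (hs _ _ _ hx) with rfl | rfl <;>
      rcases hmem y ((hs _ _ _ hy).trans hfij.symm) with rfl | rfl
    · exact absurd rfl hxy
    · omega
    · exact ⟨rfl, rfl⟩
    · exact absurd rfl hxy
  rcases isCrossing_or_isContact (L := L) (k := k') (i := y) (j := x) (by omega) (by omega)
    with ⟨hc, -⟩ | hc
  · exact hkk ((L.crossing y x hij.ne).unique hc hcr)
  · exact hij.ne (hg (le_antisymm (hL k' y x hc) (hL' k x y hct)))

/-- The value of the label of a pseudoline under a permutation, as a linear functional. -/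
def permFunctional (σ : Equiv.Perm (Fin n)) (i : Fin n) : ℝ := (σ i : ℕ)

lemma permFunctional_lt {σ : Equiv.Perm (Fin n)} {i j : Fin n} :
    permFunctional σ i < permFunctional σ j ↔ σ i < σ j := by
  simp [permFunctional]

lemma permFunctional_injective (σ : Equiv.Perm (Fin n)) :
    Function.Injective (permFunctional σ) := fun i j h => by
  simpa [permFunctional, Fin.val_inj] using h

/-- At most one arrangement is compatible with a given linear order of the pseudolines. The order is
walked to the order of the labels through exchanges of consecutive values. Across such an exchange,
the compatible arrangements change only by exchanging the two pseudolines, which share a color in the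
common degeneration `f` of the two orders. Choosing a counterexample that maximizes the sum of
`i * σ i` replaces the induction. -/
theorem eq_of_isCompatible_permFunctional (σ : Equiv.Perm (Fin n)) {L₁ L₂ : Arrangement N}
    (h₁ : L₁.IsCompatible (permFunctional σ)) (h₂ : L₂.IsCompatible (permFunctional σ)) :
    L₁ = L₂ := by
  by_contra hne
  obtain ⟨σ, ⟨L₁, L₂, h₁, h₂, hne⟩, hmax⟩ := Set.exists_max_image
    {σ : Equiv.Perm (Fin n) | ∃ L₁ L₂ : Arrangement N, L₁.IsCompatible (permFunctional σ) ∧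
      L₂.IsCompatible (permFunctional σ) ∧ L₁ ≠ L₂}
    (fun σ => ∑ i : Fin n, ((i : ℕ) : ℝ) * permFunctional σ i) (Set.toFinite _)
    ⟨σ, L₁, L₂, h₁, h₂, hne⟩
  clear * - h₁ h₂ hne hmax
  set g := permFunctional σ with hgdef
  have hg : Function.Injective g := permFunctional_injective σ
  by_cases hinv : ∃ p : Fin n × Fin n, p.1 < p.2 ∧ g p.2 < g p.1
  · -- An inversion with the smallest gap consists of two labels with consecutive values.
    obtain ⟨⟨a, b⟩, ⟨hab, hgab⟩, hmin⟩ := Set.exists_min_image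
      {p : Fin n × Fin n | p.1 < p.2 ∧ g p.2 < g p.1} (fun p => g p.1 - g p.2) (Set.toFinite _) hinv
    simp only at hab hgab hmin
    have hadj : ∀ c, g b < g c → g a ≤ g c := by
      intro c hbc
      by_contra! hca
      rcases lt_or_ge c b with hcb | hcb
      · have := hmin (c, b) ⟨hcb, hbc⟩
        simp only at this
        linarith
      · have := hmin (a, c) ⟨hab.trans_le hcb, hca⟩
        simp only at this
        linarith
    let f := Function.update g b (g a)
    let σ' := (Equiv.swap a b).trans σ
    have hfb : f b = g a := Function.update_self ..
    have hfx : ∀ x, x ≠ b → f x = g x := fun x hx => Function.update_of_ne hx ..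
    have hga : permFunctional σ' a = g b := by simp [σ', permFunctional, hgdef]
    have hgb : permFunctional σ' b = g a := by simp [σ', permFunctional, hgdef]
    have hgx : ∀ x, x ≠ a → x ≠ b → permFunctional σ' x = g x := fun x hx hx' => by
      simp [σ', permFunctional, hgdef, Equiv.swap_apply_of_ne_of_ne hx hx']
    have hmono : ∀ x y, g x ≤ g y → f x ≤ f y := by
      intro x y hxy
      by_cases hx : x = b <;> by_cases hy : y = b
      · rw [hx, hy]
      · rw [hx, hfb, hfx y hy]
        exact hadj y (lt_of_le_of_ne (hx ▸ hxy) fun h => hy (hg h).symm)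
      · rw [hy, hfb, hfx x hx]
        exact hxy.trans (hy ▸ hgab.le)
      · rwa [hfx x hx, hfx y hy]
    have hrefine : ∀ x y, f x < f y → permFunctional σ' x < permFunctional σ' y := by
      intro x y hxy
      have key : ∀ z, z ≠ a → z ≠ b → g z < g a → g z < g b := fun z _ hz hlt =>
        lt_of_le_of_ne (not_lt.1 fun h => (hadj z h).not_gt hlt) fun h => hz (hg h)
      have hfa : f a = g a := hfx a hab.ne
      by_cases hx : x = a ∨ x = b
      · have hfx' : f x = g a := by rcases hx with rfl | rfl <;> assumption
        have hy : y ≠ a ∧ y ≠ b := by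
          constructor <;> rintro rfl <;> rw [hfx'] at hxy
          · exact (hfa ▸ hxy).false
          · exact (hfb ▸ hxy).false
        rw [hfx', hfx y hy.2] at hxy
        rw [hgx y hy.1 hy.2]
        rcases hx with rfl | rfl
        · rw [hga]; exact hgab.trans hxy
        · rw [hgb]; exact hxy
      · rw [not_or] at hx
        rw [hfx x hx.2] at hxy
        rw [hgx x hx.1 hx.2]
        by_cases hy : y = a ∨ y = b
        · have hfy : f y = g a := by rcases hy with rfl | rfl <;> assumption
          have := key x hx.1 hx.2 (hfy ▸ hxy)
          rcases hy with rfl | rfl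
          · rwa [hga]
          · rw [hgb]; exact this.trans hgab
        · rw [not_or] at hy
          rw [hgx y hy.1 hy.2]
          rwa [hfx y hy.2] at hxy
    obtain ⟨M₁, hM₁, hc₁⟩ := exists_sameColoring_isCompatible
      (fun k i j hk => hmono i j (h₁ k i j hk) : L₁.IsCompatible f) hrefine
    obtain ⟨M₂, hM₂, hc₂⟩ := exists_sameColoring_isCompatible
      (fun k i j hk => hmono i j (h₂ k i j hk) : L₂.IsCompatible f) hrefine
    have hMM : M₁ = M₂ := by
      by_contra hM
      have hle := hmax σ' ⟨M₁, M₂, hc₁, hc₂, hM⟩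
      -- Removing the inversion increases the sum, by the rearrangement inequality.
      have hsum : ∑ i : Fin n, ((i : ℕ) : ℝ) * permFunctional σ' i -
          ∑ i : Fin n, ((i : ℕ) : ℝ) * g i =
          (((b : ℕ) : ℝ) - (a : ℕ)) * (g a - g b) := by
        rw [← Finset.sum_sub_distrib, Fintype.sum_eq_add a b hab.ne fun x hx => by
          rw [hgx x hx.1 hx.2, sub_self], hga, hgb]
        ring
      have : ((a : ℕ) : ℝ) < (b : ℕ) := by exact_mod_cast hab
      nlinarith
    subst hMM
    refine hne (eq_of_sameColoring hg (f := f) (fun x y z hxy hyz => ?_) h₁ h₂ (hM₁.trans hM₂.symm))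
    by_contra! hxyz
    have hfg : ∀ u v, u ≠ v → f u = f v → u = b ∨ v = b := by
      intro u v huv h
      by_contra! hb
      rw [hfx u hb.1, hfx v hb.2] at h
      exact huv (hg h)
    have := hfg x y hxyz.1 hxy
    have := hfg y z hxyz.2.1 hyz
    have := hfg x z hxyz.2.2 (hxy.trans hyz)
    grind
  · -- For the order of the labels, a contact before the crossing is forbidden, so the pseudolines cross
    -- as soon as possible.
    obtain ⟨L, L', hLL, k, i, j, hij, -, -, hct⟩ := exists_first_difference hne
    have hL' : L'.IsCompatible g := by
      rcases hLL with ⟨-, rfl⟩ | ⟨-, rfl⟩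
      exacts [h₂, h₁]
    have h := hL' k j i hct
    exact hinv ⟨(i, j), hij, lt_of_le_of_ne h fun h => hij.ne' (hg h)⟩

/-! ### Local minima are global minima -/

/-- An arrangement compatible with `f` minimizes `f` among the brick vectors. Break the ties of `f` by
a linear order: both the given arrangement, keeping its coloring, and any other one, without increasing
`f`, can be moved to an arrangement compatible with this order, and there is only one. -/
theorem IsCompatible.dotProduct_le (hL : L.IsCompatible f) (L' : Arrangement N) :
    f ⬝ᵥ L.brickVector ≤ f ⬝ᵥ L'.brickVector := by
  let σ := (Tuple.sort f).symm
  have hσ : ∀ i j, f i < f j → permFunctional σ i < permFunctional σ j := by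
    intro i j hij
    rw [permFunctional_lt]
    by_contra! h
    have := Tuple.monotone_sort f h
    simp only [σ, Function.comp_apply, Equiv.apply_symm_apply] at this
    exact hij.not_ge this
  obtain ⟨M, hM, hMc⟩ := exists_sameColoring_isCompatible hL hσ
  obtain ⟨M', hM', hmin⟩ := Set.exists_min_image
    {M : Arrangement N | f ⬝ᵥ M.brickVector ≤ f ⬝ᵥ L'.brickVector}
    (fun M => permFunctional σ ⬝ᵥ M.brickVector) (Set.toFinite _) ⟨L', le_refl (f ⬝ᵥ L'.brickVector)⟩
  have hMc' : M'.IsCompatible (permFunctional σ) := by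
    intro k i j hk
    by_contra! hlt
    obtain ⟨M'', -, h2, h3⟩ := exists_flip_dotProduct hk
    have hf : f j ≤ f i := not_lt.1 fun h => hlt.not_gt (hσ i j h)
    exact (h3 _ hlt).not_ge (hmin M'' ((h2 f hf).trans hM'))
  rw [hM.dotProduct_brickVector_eq, eq_of_isCompatible_permFunctional σ hMc hMc']
  exact hM'

end Arrangement

/-! ### Duality for finitely generated cones -/

/-- **Farkas' lemma** for finitely generated cones, by induction on the generators: if `φ` separates
`b` from the cone of all generators but `v a`, then `φ (v a) < 0`, and the projection to the kernel of
`φ` along `v a` reduces the claim to one generator less. -/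
theorem mem_hull_image_of_forall_nonneg {ι V : Type*} [AddCommGroup V] [Module ℝ V] (s : Finset ι)
    (v : ι → V) (b : V) (h : ∀ φ : V →ₗ[ℝ] ℝ, (∀ a ∈ s, 0 ≤ φ (v a)) → 0 ≤ φ b) :
    b ∈ PointedCone.hull ℝ (v '' s) := by
  classical
  induction s using Finset.induction_on generalizing v b with
  | empty =>
    have hb : b = 0 := by
      refine (Module.forall_dual_apply_eq_zero_iff ℝ b).1 fun φ => le_antisymm ?_ (h φ (by simp))
      simpa using h (-φ) (by simp)
    rw [hb]
    exact zero_mem _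
  | insert a s _ ih =>
    by_contra hb
    have hsub : PointedCone.hull ℝ (v '' s) ≤ PointedCone.hull ℝ (v '' (insert a s : Finset ι)) :=
      Submodule.span_mono (Set.image_mono (by simp))
    have ha : v a ∈ PointedCone.hull ℝ (v '' (insert a s : Finset ι)) :=
      Submodule.subset_span ⟨a, by simp, rfl⟩
    have hbs : ∃ φ : V →ₗ[ℝ] ℝ, (∀ a ∈ s, 0 ≤ φ (v a)) ∧ φ b < 0 := by
      by_contra! hno
      exact hb (hsub (ih v b hno))
    obtain ⟨φ, hφ, hφb⟩ := hbs
    have hφa : φ (v a) < 0 := by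
      by_contra! hφa
      refine hφb.not_ge (h φ fun c hc => ?_)
      rcases Finset.mem_insert.1 hc with rfl | hc
      exacts [hφa, hφ c hc]
    -- Project to the kernel of `φ` along the generator `v a`.
    let π : V →ₗ[ℝ] V := LinearMap.id - (φ (v a))⁻¹ • φ.smulRight (v a)
    have hπ : ∀ x, π x = x - ((φ (v a))⁻¹ * φ x) • v a := fun x => by
      simp [π, mul_smul]
    have hπb : π b ∈ PointedCone.hull ℝ ((fun c => π (v c)) '' s) := by
      refine ih _ _ fun ψ hψ => h (ψ ∘ₗ π) fun c hc => ?_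
      rcases Finset.mem_insert.1 hc with rfl | hc
      · simp [hπ, hφa.ne]
      · exact hψ c hc
    have hle : PointedCone.hull ℝ ((fun c => π (v c)) '' s) ≤
        PointedCone.hull ℝ (v '' (insert a s : Finset ι)) := by
      refine Submodule.span_le.2 ?_
      rintro _ ⟨c, hc, rfl⟩
      change π (v c) ∈ _
      rw [hπ, sub_eq_add_neg, ← neg_smul]
      refine add_mem (Submodule.subset_span ⟨c, by simp [Finset.mem_coe.1 hc], rfl⟩)
        (PointedCone.smul_mem _ ?_ ha)
      exact neg_nonneg.2 (mul_nonpos_of_nonpos_of_nonneg (inv_nonpos.2 hφa.le) (hφ c hc))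
    refine hb ?_
    have : b = π b + ((φ (v a))⁻¹ * φ b) • v a := by rw [hπ]; abel
    rw [this]
    exact add_mem (hle hπb) (PointedCone.smul_mem _
      (mul_nonneg_of_nonpos_of_nonpos (inv_nonpos.2 hφa.le) hφb.le) ha)

end BrickPolytope

/-! ### The cone of the brick polytope at a brick vector -/

theorem mainTheorem1 {n m : ℕ} (N : BrickPolytope.Network n m) (hN : N.IsIrreducible)
    (L : BrickPolytope.Arrangement N) :
    BrickPolytope.coneAt N.brickPolytope L.brickVector = L.contactGraph.incidenceCone ∧
    PointedCone.hull ℝ {v : Fin n → ℝ | ∃ L' : BrickPolytope.Arrangement N,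
      v = L'.brickVector - L.brickVector} = L.contactGraph.incidenceCone := by
  set D : Set (Fin n → ℝ) := {v | ∃ L' : BrickPolytope.Arrangement N,
    v = L'.brickVector - L.brickVector} with hD
  have hcone : BrickPolytope.coneAt N.brickPolytope L.brickVector = PointedCone.hull ℝ D := by
    refine le_antisymm (Submodule.span_le.2 ?_) (Submodule.span_mono ?_)
    · rintro _ ⟨y, hy, rfl⟩
      have hconv : Convex ℝ ((fun y => y - L.brickVector) ⁻¹' (PointedCone.hull ℝ D : Set _)) := by
        simpa only [sub_eq_add_neg, add_comm _ (-L.brickVector)] using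
          (PointedCone.convex (PointedCone.hull ℝ D)).translate_preimage_right (-L.brickVector)
      refine convexHull_min ?_ hconv hy
      rintro _ ⟨L', rfl⟩
      exact Submodule.subset_span ⟨L', rfl⟩
    · rintro _ ⟨L', rfl⟩
      exact ⟨L'.brickVector, subset_convexHull ℝ _ ⟨L', rfl⟩, rfl⟩
  have hmain : PointedCone.hull ℝ D = L.contactGraph.incidenceCone := by
    refine le_antisymm (Submodule.span_le.2 ?_) (Submodule.span_le.2 ?_)
    · rintro _ ⟨L', rfl⟩
      -- By Farkas' lemma, it suffices to test the functionals nonnegative on the generators.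
      have hfin : L.contactGraph.incidenceConfiguration.Finite := by
        refine (Set.finite_range fun p : Fin n × Fin n =>
          (Pi.single p.2 1 - Pi.single p.1 1 : Fin n → ℝ)).subset ?_
        rintro _ ⟨a, rfl⟩
        exact ⟨(L.contactGraph.source a, L.contactGraph.target a), rfl⟩
      have := BrickPolytope.mem_hull_image_of_forall_nonneg hfin.toFinset id
        (L'.brickVector - L.brickVector) fun φ hφ => ?_
      · simpa [BrickPolytope.DirectedMultigraph.incidenceCone] using this
      · have hrep : ∀ x, φ x = (fun i => φ (Pi.single i 1)) ⬝ᵥ x := fun x => by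
          rw [LinearMap.pi_apply_eq_sum_univ φ x]
          refine Finset.sum_congr rfl fun i _ => ?_
          rw [smul_eq_mul, mul_comm]
          congr 2
          ext j
          simp [Pi.single_apply, eq_comm]
        rw [map_sub, sub_nonneg, hrep, hrep]
        refine BrickPolytope.Arrangement.IsCompatible.dotProduct_le (fun k i j hk => ?_) L'
        have := hφ _ (hfin.mem_toFinset.2 ⟨⟨(k, i, j), hk⟩, rfl⟩)
        rw [id, map_sub, sub_nonneg] at this
        exact this
    · rintro _ ⟨⟨⟨k, i, j⟩, hk⟩, rfl⟩
      obtain ⟨L', c, hc, hv, -⟩ := BrickPolytope.Arrangement.exists_flip hk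
      have : (Pi.single j 1 - Pi.single i 1 : Fin n → ℝ) =
          c⁻¹ • (L'.brickVector - L.brickVector) := by
        rw [hv, smul_smul, inv_mul_cancel₀ hc.ne', one_smul]
      change (Pi.single j 1 - Pi.single i 1 : Fin n → ℝ) ∈ PointedCone.hull ℝ D
      rw [this]
      exact PointedCone.smul_mem _ (inv_nonneg.2 hc.le) (Submodule.subset_span ⟨L', rfl⟩)
  exact ⟨hcone.trans hmain, hmain⟩
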